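/- Let $V$ be a finite set and let $G$ be a multivariate regression (MVR) chain graph on $V$: a simple mixed graph with edges $a\to b$ and $a\leftrightarrow b$ and without partially directed cycles. Let $p$ be the joint distribution of random variables $(X_v)_{v\in V}$ with values in standard Borel spaces, and assume that $p$ is faithful to $G$: for all disjoint $A,B,S\subseteq V$ with $A,B\neq\emptyset$, $X_A\perp\!\!\!\perp X_B\mid X_S$ under $p$ if and only if $A$ and $B$ are $m$-separated given $S$ in $G$. Here $A$ and $B$ are $m$-separated given $S$ if no chain (sequence of distinct, consecutively adjacent vertices) between a vertex of $A$ and a vertex of $B$ is such that all its non-endpoint noncolliders lie outside $S$ and all its non-endpoint colliders have a (possibly trivial) directed path to $S$. Let $T$ be an $m$-separation tree for $G$: a tree whose nodes are distinct sets $C_1,\dots,C_H\subseteq V$ with $\bigcup_h C_h=V$, such that for each edge $(C_i,C_j)$ of $T$, with $S=C_i\cap C_j$ and with $V_1,V_2$ the unions of the nodes in the two subtrees obtained by removing that edge, $V_1\setminus S$ and $V_2\setminus S$ are disjoint and $m$-separated given $S$ in $G$ (which holds trivially if one of them is empty). Consider the following algorithm with input $p$ and $T$. 1. For each $h$, start from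 the complete undirected graph on $C_h$. For each pair of distinct $u,v\in C_h$, if there is a set $S_{uv}\subseteq C_h\setminus\{u,v\}$ with $X_u\perp\!\!\!\perp X_v\mid X_{S_{uv}}$ under $p$, choose any such set, delete the edge $(u,v)$ and store $S_{uv}$ together with the pair $\{u,v\}$. The result is the local skeleton of $C_h$. 2. Take the union of all local skeletons, and delete each edge $(u,v)$ of it for which there is a node $C_h\supseteq\{u,v\}$ whose local skeleton does not contain $(u,v)$. The result is the output skeleton. 3. For each stored separator $S_{uv}$ and each common neighbour $w$ of $u$ and $v$ in the output skeleton with $w\notin S_{uv}$, determine the $v$-structure at $w$ with ends $u,v$, that is, put arrowheads at $w$ on the edges $(u,w)$ and $(v,w)$. Then, whichever separators are chosen in step 1: (i) the output skeleton is exactly the skeleton of $G$, i.e. the undirected graph obtained from $G$ by dropping all edge marks; (ii) for all $u,w,v\in V$, the algorithm determines the $v$-structure at $w$ with ends $u,v$ if and only if it is a $v$-structure of $G$, i.e. $u\ne v$ are non-adjacent in $G$ and both are joined to $w$ by edges of $G$ with an arrowhead at $w$; (iii) consequently the output is the pattern of $G$: the skeleton of $G$ with exactly those arrowheads that occur in $v$-structures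 of $G$. -/

import Mathlib

open MeasureTheory ProbabilityTheory

namespace MVR

/-- A multivariate regression chain graph on the vertex set `V`: a mixed graph with directed edges
(`dir a b` is `a → b`) and bidirected edges (`bi a b` is `a ↔ b`), without loops, with at most one
edge between two vertices, and without partially directed cycles. -/
structure ChainGraph (V : Type*) where
  dir : V → V → Prop
  bi : V → V → Prop
  bi_symm : ∀ a b, bi a b → bi b a
  bi_irrefl : ∀ a, ¬ bi a a
  dir_irrefl : ∀ a, ¬ dir a a
  dir_asymm : ∀ a b, dir a b → ¬ dir b a
  dir_not_bi : ∀ a b, dir a b → ¬ bi a b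
  /-- There are no distinct vertices `c 0, …, c (n + 2)` (indices are cyclic, so that `i + 1 = 0`
  for the last index `i`) such that each `c i` is joined to `c (i + 1)` by `↔` or `→`, with at
  least one `→` among these edges. -/
  no_partially_directed_cycle : ∀ (n : ℕ) (c : Fin (n + 3) → V), Function.Injective c →
    (∀ i, bi (c i) (c (i + 1)) ∨ dir (c i) (c (i + 1))) → ¬ ∃ j, dir (c j) (c (j + 1))

namespace ChainGraph

variable {V : Type*} (G : ChainGraph V)

/-- There is an edge between `a` and `b` with an arrowhead at `b`: `a → b` or `a ↔ b`. -/
def ArrowInto (a b : V) : Prop := G.dir a b ∨ G.bi a b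

/-- The (global) skeleton: the undirected graph obtained by dropping all edge marks. -/
def skeleton : SimpleGraph V where
  Adj a b := G.dir a b ∨ G.dir b a ∨ G.bi a b
  symm := ⟨fun a b h => by
    rcases h with h | h | h
    · exact Or.inr (Or.inl h)
    · exact Or.inl h
    · exact Or.inr (Or.inr (G.bi_symm a b h))⟩
  loopless := ⟨fun a h => by
    rcases h with h | h | h
    · exact G.dir_irrefl a h
    · exact G.dir_irrefl a h
    · exact G.bi_irrefl a h⟩

/-- `An(Z)`: the vertices with a (possibly trivial) directed path to a vertex of `Z`. -/
def An (Z : Set V) : Set V := {a | ∃ z ∈ Z, Relation.ReflTransGen G.dir a z}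

/-- `b` is a collider between its neighbours `a` and `c` on a chain. -/
def IsCollider (a b c : V) : Prop := G.ArrowInto a b ∧ G.ArrowInto c b

/-- A chain between `α` and `β` (a path in the skeleton, i.e. a sequence of distinct, consecutively
adjacent vertices) is `m`-connecting given `Z`: the endpoints are not in `Z`, every non-endpoint
noncollider is outside `Z`, and every non-endpoint collider is in `An(Z)`. -/
def IsMConnecting {α β : V} (ρ : G.skeleton.Walk α β) (Z : Set V) : Prop :=
  ρ.IsPath ∧ α ∉ Z ∧ β ∉ Z ∧
    ∀ i, i + 2 ≤ ρ.length →
      (¬ G.IsCollider (ρ.getVert i) (ρ.getVert (i + 1)) (ρ.getVert (i + 2)) →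
        ρ.getVert (i + 1) ∉ Z) ∧
      (G.IsCollider (ρ.getVert i) (ρ.getVert (i + 1)) (ρ.getVert (i + 2)) →
        ρ.getVert (i + 1) ∈ G.An Z)

/-- `X` and `Y` are `m`-separated given `Z` in `G`: the three sets are disjoint and no chain
between a vertex of `X` and a vertex of `Y` is `m`-connecting given `Z`. -/
def MSeparated (X Y Z : Set V) : Prop :=
  Disjoint X Y ∧ Disjoint X Z ∧ Disjoint Y Z ∧
    ∀ α ∈ X, ∀ β ∈ Y, ¬ ∃ ρ : G.skeleton.Walk α β, G.IsMConnecting ρ Z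

/-- `u ∘→ w ←∘ v` is a `v`-structure (unshielded collider) of `G`. -/
def IsVStructure (u w v : V) : Prop :=
  u ≠ v ∧ ¬ G.skeleton.Adj u v ∧ G.ArrowInto u w ∧ G.ArrowInto v w

end ChainGraph

/-- The union of the sets `C k` over the nodes `k` in the component of `i` after the edge between
`i` and `j` has been removed from the tree `T`. -/
def side {V ι : Type*} (T : SimpleGraph ι) (C : ι → Finset V) (i j : ι) : Set V :=
  {x | ∃ k, (T.deleteEdges {s(i, j)}).Reachable i k ∧ x ∈ C k}

/-- `T`, with the set `C h` of variables at the node `h`, is an `m`-separation tree for `G`. -/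
structure IsMSeparationTree {V ι : Type*} [DecidableEq V] (G : ChainGraph V)
    (T : SimpleGraph ι) (C : ι → Finset V) : Prop where
  isTree : T.IsTree
  distinct : Function.Injective C
  cover : ∀ x, ∃ h, x ∈ C h
  separates : ∀ i j, T.Adj i j →
    G.MSeparated (side T C i j \ ↑(C i ∩ C j)) (side T C j i \ ↑(C i ∩ C j)) ↑(C i ∩ C j)

section Distribution

variable {V : Type*} [Finite V] {E : V → Type*} [∀ v, MeasurableSpace (E v)]
  [∀ v, StandardBorelSpace (E v)]

/-- `X_A ⊥⊥ X_B | X_S` under the joint distribution `p` of the variables `(X_v)_{v ∈ V}`. -/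
def CondIndepGiven (p : Measure (∀ v, E v)) [IsProbabilityMeasure p] (A B S : Finset V) : Prop :=
  CondIndepFun (MeasurableSpace.comap (S.restrict (π := E)) inferInstance)
    (Finset.measurable_restrict S).comap_le (A.restrict (π := E)) (B.restrict (π := E)) p

/-- `p` is faithful to `G`: the conditional independencies among the variables under `p` are
exactly those read off from `G` by `m`-separation. -/
def Faithful (p : Measure (∀ v, E v)) [IsProbabilityMeasure p] (G : ChainGraph V) : Prop :=
  ∀ A B S : Finset V, A.Nonempty → B.Nonempty → Disjoint A B → Disjoint A S → Disjoint B S →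
    (CondIndepGiven p A B S ↔ G.MSeparated ↑A ↑B ↑S)

/-- `S` is an admissible separator of `u` and `v` inside the variable set `D`: a subset of `D`,
not containing `u` and `v`, with `u ⊥⊥ v | S` under `p`. -/
def IsLocalSeparator (p : Measure (∀ v, E v)) [IsProbabilityMeasure p] (D : Finset V) (u v : V)
    (S : Finset V) : Prop :=
  S ⊆ D ∧ u ∉ S ∧ v ∉ S ∧ CondIndepGiven p {u} {v} S

/-- The result of the searches in the first loop of the algorithm: for every node `h` and
every pair of distinct vertices `{u, v} ⊆ C h` a set `S_{uv} ⊆ C h` with `u ⊥⊥ v | S_{uv}` is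
found whenever there is one. Which one is found (possibly a different one at each node) is left
open. -/
structure SeparatorSearch {ι : Type*} (p : Measure (∀ v, E v)) [IsProbabilityMeasure p]
    (C : ι → Finset V) where
  found : ι → Sym2 V → Option (Finset V)
  sound : ∀ h u v S, found h s(u, v) = some S →
    u ≠ v ∧ u ∈ C h ∧ v ∈ C h ∧ IsLocalSeparator p (C h) u v S
  complete : ∀ h u v, u ≠ v → u ∈ C h → v ∈ C h →
    (∃ S, IsLocalSeparator p (C h) u v S) → found h s(u, v) ≠ none

end Distribution

/-- A partially oriented graph: a skeleton, with arrowheads at some edge ends. `head u w` says that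
the edge between `u` and `w` has an arrowhead at `w`. So the edge is undirected if neither
`head u w` nor `head w u` holds, bidirected if both hold, and directed otherwise. -/
@[ext] structure PartiallyOrientedGraph (V : Type*) where
  skel : SimpleGraph V
  head : V → V → Prop
  head_adj : ∀ u w, head u w → skel.Adj u w

/-- The pattern of `G`: the skeleton of `G`, with exactly the arrowheads that occur in
`v`-structures of `G`. -/
def ChainGraph.pattern {V : Type*} (G : ChainGraph V) : PartiallyOrientedGraph V where
  skel := G.skeleton
  head u w := ∃ v, G.IsVStructure u w v
  head_adj := fun _ _ ⟨_, _, _, h, _⟩ => h.elim Or.inl fun h => Or.inr (Or.inr h)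

namespace SeparatorSearch

variable {V ι : Type*} [Finite V] {E : V → Type*} [∀ v, MeasurableSpace (E v)]
  [∀ v, StandardBorelSpace (E v)] {p : Measure (∀ v, E v)} [IsProbabilityMeasure p]
  {C : ι → Finset V} (R : SeparatorSearch p C)

/-- First loop, edges: the local skeleton at the node `h`, that is the complete graph on `C h`
without the edges `(u, v)` for which a separator was found. -/
def localSkeleton (h : ι) : SimpleGraph V where
  Adj u v := u ≠ v ∧ u ∈ C h ∧ v ∈ C h ∧ R.found h s(u, v) = none
  symm := ⟨fun u v ⟨h1, h2, h3, h4⟩ => ⟨h1.symm, h3, h2, by rwa [Sym2.eq_swap]⟩⟩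
  loopless := ⟨fun _ hu => hu.1 rfl⟩

/-- First loop, separators: the list of all stored separators, each with its pair of vertices. -/
def stored : Set (Sym2 V × Finset V) := {r | ∃ h, R.found h r.1 = some r.2}

/-- The union of all local skeletons. -/
def unionSkeleton : SimpleGraph V := ⨆ h, R.localSkeleton h

/-- Second loop: the edges of the union that are deleted, namely those between vertices contained
together in more than one node and absent in the local skeleton of some node containing both. -/
def Deleted (u v : V) : Prop :=
  R.unionSkeleton.Adj u v ∧
    (∃ h h', h ≠ h' ∧ u ∈ C h ∧ v ∈ C h ∧ u ∈ C h' ∧ v ∈ C h') ∧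
    ∃ h, u ∈ C h ∧ v ∈ C h ∧ ¬ (R.localSkeleton h).Adj u v

/-- The global skeleton after the second loop. -/
def globalSkeleton : SimpleGraph V where
  Adj u v := R.unionSkeleton.Adj u v ∧ ¬ R.Deleted u v
  symm := ⟨fun _ _ ⟨h1, h2⟩ => ⟨h1.symm, fun ⟨_, ⟨h, h', hne, a, b, c, d⟩, k, e, f, g⟩ =>
    h2 ⟨h1, ⟨h, h', hne, b, a, d, c⟩, k, f, e, fun g' => g g'.symm⟩⟩⟩
  loopless := ⟨fun _ h => h.1.ne rfl⟩

/-- Third loop: some stored separator `S_{uv}` does not contain the common neighbour `w` of `u` and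
`v` in the global skeleton, so that the `v`-structure `u ∘→ w ←∘ v` is determined. -/
def Determined (u w v : V) : Prop :=
  ∃ S, (s(u, v), S) ∈ R.stored ∧ R.globalSkeleton.Adj u w ∧ R.globalSkeleton.Adj w v ∧ w ∉ S

/-- The output of the algorithm: the global skeleton with the arrowheads of the determined
`v`-structures. (An arrowhead at `w` on the edge between `u` and `w` comes from `u ∘→ w ←∘ v` for
some `v`; the order of `u` and `v` does not matter.) -/
def output : PartiallyOrientedGraph V where
  skel := R.globalSkeleton
  head u w := ∃ v, R.Determined u w v
  head_adj := fun _ _ ⟨_, _, _, h, _⟩ => h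

end SeparatorSearch

end MVR

/-! By faithfulness the algorithm queries `m`-separation, so an edge of `G` is never deleted, and
every edge lies inside some node. The crux is that non-adjacent `u`, `v` sharing a node have a
separator inside some, possibly different, node (`exists_separator_of_not_strictlyPrecedes`).

Without partially directed cycles strict precedence is asymmetric, so let `v` not strictly precede
`u`. Then the parents of `v` separate `v` from `u`. Move through nodes containing `u` and `v`,
collecting these parents one by one. If this never fails, one node contains them all. If `u` is lost
across a tree edge with intersection `S`, the ancestors of `u` and `v` in `S`, without `v`, separate
them (`mSeparated_ancestors`), and they lie in the node just reached.

For `v`-structures, the ends of a collider share a node, so a separator of non-adjacent ends is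
stored; any separator contains a common neighbour exactly when it is a noncollider (`mem_iff`). -/

open MeasureTheory ProbabilityTheory

namespace MVR

namespace ChainGraph

variable {V : Type*} (G : ChainGraph V)

/-! ### The order induced by arrowheads -/

/-- `a` precedes `b` weakly: there is a sequence of edges `→` and `↔` from `a` to `b`. -/
def Precedes : V → V → Prop := Relation.ReflTransGen G.ArrowInto

variable {G}

theorem Precedes.of_dir {a b : V} (h : Relation.ReflTransGen G.dir a b) : G.Precedes a b :=
  Relation.ReflTransGen.mono (fun _ _ => Or.inl) _ _ h

theorem exists_injOn_of_reflTransGen {r : V → V → Prop} {a b : V}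
    (h : Relation.ReflTransGen r a b) :
    ∃ (n : ℕ) (f : ℕ → V), f 0 = a ∧ f n = b ∧ (∀ i < n, r (f i) (f (i + 1))) ∧
      ∀ i j, i < j → j ≤ n → f i ≠ f j := by
  classical
  have hex : ∃ (n : ℕ) (f : ℕ → V), f 0 = a ∧ f n = b ∧ ∀ i < n, r (f i) (f (i + 1)) := by
    induction h with
    | refl => exact ⟨0, fun _ => a, rfl, rfl, by simp⟩
    | @tail c d _ hcd ih =>
      obtain ⟨n, f, h0, hn, hs⟩ := ih
      refine ⟨n + 1, fun k => if k ≤ n then f k else d, by simp [h0], by simp, fun i hi => ?_⟩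
      rcases Nat.lt_succ_iff_lt_or_eq.1 hi with hi | rfl
      · simpa [hi.le, Nat.succ_le_of_lt hi] using hs i hi
      · simpa [hn] using hcd
  obtain ⟨f, h0, hn, hs⟩ := Nat.find_spec hex
  refine ⟨Nat.find hex, f, h0, hn, hs, fun i j hij hj heq => ?_⟩
  -- A repeated vertex would allow cutting out the loop between `i` and `j`, contradicting minimal
  -- length.
  refine Nat.find_min hex (m := Nat.find hex - (j - i)) (by omega)
    ⟨fun k => if k ≤ i then f k else f (k + (j - i)), by simp [h0], ?_, fun k hk => ?_⟩
  · by_cases hji : j = Nat.find hex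
    · have : Nat.find hex - (j - i) = i := by omega
      simp only [this, le_refl, if_true]
      rw [heq, hji, hn]
    · have h1 : ¬ Nat.find hex - (j - i) ≤ i := by omega
      have h2 : Nat.find hex - (j - i) + (j - i) = Nat.find hex := by omega
      simp only [h1, if_false, h2, hn]
  · rcases lt_trichotomy k i with hki | rfl | hki
    · have h1 : k + 1 ≤ i := hki
      simpa [hki.le, h1] using hs k (by omega)
    · have h2 : k + 1 + (j - k) = j + 1 := by omega
      simp only [le_refl, if_true, Nat.not_succ_le_self, if_false, h2, heq]
      exact hs j (by omega)
    · have h1 : ¬ k ≤ i := by omega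
      have h2 : ¬ k + 1 ≤ i := by omega
      have h3 : k + 1 + (j - i) = k + (j - i) + 1 := by omega
      simp only [h1, h2, if_false, h3]
      exact hs _ (by omega)

theorem not_precedes_of_dir {a b : V} (hab : G.dir a b) : ¬ G.Precedes b a := by
  intro h
  obtain ⟨n, f, h0, hn, hs, hinj⟩ := exists_injOn_of_reflTransGen h
  match n, hn, hs, hinj with
  | 0, hn, _, _ => exact G.dir_irrefl b (by rwa [← h0.symm.trans hn] at hab)
  | 1, hn, hs, _ =>
    have := hs 0 one_pos
    rw [zero_add, h0, hn] at this
    rcases this with h | h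
    · exact G.dir_asymm _ _ hab h
    · exact G.dir_not_bi _ _ hab (G.bi_symm _ _ h)
  | m + 2, hn, hs, hinj =>
    -- The edge `a → b` closes the sequence from `b` to `a` into a forbidden cycle on `m + 3`
    -- vertices.
    have hlast : (Fin.last (m + 2)) + 1 = 0 := by simp
    have hdir : G.dir (f (Fin.last (m + 2)).val) (f ((Fin.last (m + 2)) + 1).val) := by
      rw [hlast]
      simpa [h0, hn] using hab
    refine G.no_partially_directed_cycle m (fun i => f i.val) (fun i j hij => ?_)
      (fun i => ?_) ⟨_, hdir⟩
    · by_contra hne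
      rcases lt_or_gt_of_ne (Fin.val_ne_of_ne hne) with hlt | hlt
      · exact hinj _ _ hlt (by omega) hij
      · exact hinj _ _ hlt (by omega) hij.symm
    · by_cases hi : i = Fin.last (m + 2)
      · subst hi
        exact Or.inr hdir
      · have hv : (i + 1).val = i.val + 1 := Fin.val_add_one_of_lt (Fin.lt_last_iff_ne_last.2 hi)
        have := hs i.val (Fin.val_lt_last hi)
        simp only [hv]
        exact this.symm

variable (G) in
/-- `a` precedes `b` strictly: some sequence of edges `→` and `↔` from `a` to `b` contains `→`. -/
def StrictlyPrecedes (a b : V) : Prop := ∃ c d, G.Precedes a c ∧ G.dir c d ∧ G.Precedes d b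

theorem StrictlyPrecedes.asymm {a b : V} (h : G.StrictlyPrecedes a b) :
    ¬ G.StrictlyPrecedes b a := by
  rintro ⟨c, d, hbc, hcd, hda⟩
  obtain ⟨c', d', hac, hcd', hdb⟩ := h
  exact not_precedes_of_dir hcd (hda.trans (hac.trans (.head (Or.inl hcd') (hdb.trans hbc))))

/-! ### Ancestors and separation along short chains -/

theorem subset_An (Z : Set V) : Z ⊆ G.An Z := fun z hz => ⟨z, hz, .refl⟩

theorem An_mono {Z W : Set V} (h : Z ⊆ W) : G.An Z ⊆ G.An W :=
  fun _ ⟨z, hz, hp⟩ => ⟨z, h hz, hp⟩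

theorem mem_An_of_dir {Z : Set V} {a b : V} (h : G.dir a b) (hb : b ∈ G.An Z) : a ∈ G.An Z := by
  obtain ⟨z, hz, hp⟩ := hb
  exact ⟨z, hz, .head h hp⟩

theorem An_subset_An {Z W : Set V} (h : Z ⊆ G.An W) : G.An Z ⊆ G.An W := by
  rintro a ⟨z, hz, hp⟩
  obtain ⟨w, hw, hq⟩ := h hz
  exact ⟨w, hw, hp.trans hq⟩

theorem ArrowInto.adj {a b : V} (h : G.ArrowInto a b) : G.skeleton.Adj a b :=
  h.elim Or.inl fun h => Or.inr (Or.inr h)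

theorem ArrowInto.not_dir {a b : V} (h : G.ArrowInto a b) : ¬ G.dir b a := fun hd =>
  h.elim (G.dir_asymm _ _ hd) fun hb => G.dir_not_bi _ _ hd (G.bi_symm _ _ hb)

theorem dir_of_adj_of_not_arrowInto {a b : V} (h : G.skeleton.Adj a b) (hn : ¬ G.ArrowInto a b) :
    G.dir b a := by
  rcases h with h | h | h
  · exact absurd (Or.inl h) hn
  · exact h
  · exact absurd (Or.inr h) hn

theorem MSeparated.not_adj {X Y Z : Set V} (h : G.MSeparated X Y Z) {u v : V} (hu : u ∈ X)
    (hv : v ∈ Y) : ¬ G.skeleton.Adj u v := by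
  intro huv
  refine h.2.2.2 u hu v hv ⟨.cons huv .nil, ?_, h.2.1.notMem_of_mem_left hu,
    h.2.2.1.notMem_of_mem_left hv, fun i hi => by simp at hi⟩
  simpa using huv.ne

/-- The chain `u, w, v` has `w` as its only inner vertex, so it must be blocked there. -/
theorem MSeparated.mem_iff {X Y Z : Set V} (h : G.MSeparated X Y Z) {u w v : V} (hu : u ∈ X)
    (hv : v ∈ Y) (huw : G.skeleton.Adj u w) (hwv : G.skeleton.Adj w v) :
    w ∈ Z ↔ ¬ G.IsCollider u w v := by
  have huv : u ≠ v := fun e => h.1.notMem_of_mem_left hu (e ▸ hv)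
  have key := fun hc => h.2.2.2 u hu v hv ⟨.cons huw (.cons hwv .nil),
    by simp [huw.ne, hwv.ne, huv], h.2.1.notMem_of_mem_left hu,
    h.2.2.1.notMem_of_mem_left hv, fun i hi => by
      obtain rfl : i = 0 := by simpa using hi
      exact hc⟩
  simp only [SimpleGraph.Walk.getVert_cons_succ, SimpleGraph.Walk.getVert_zero] at key
  by_cases hcol : G.IsCollider u w v
  · exact iff_of_false (fun hw => key ⟨fun hn => absurd hcol hn, fun _ => subset_An Z hw⟩)
      (not_not.2 hcol)
  · refine iff_of_true ?_ hcol
    by_contra hw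
    exact key ⟨fun _ => hw, fun hc => absurd hc hcol⟩

/-! ### Inner vertices of connecting chains -/

section Connecting

variable {α β : V} {Z : Set V} {ρ : G.skeleton.Walk α β}

/-- Follow the chain along its outgoing arrows: they reach either the end `β` or a collider, which
is an ancestor of `Z`. Here `k` counts the remaining edges. -/
theorem IsMConnecting.mem_An_of_dir_succ (h : G.IsMConnecting ρ Z) (k : ℕ) :
    ∀ i, i + 1 + k = ρ.length → G.dir (ρ.getVert i) (ρ.getVert (i + 1)) →
      ρ.getVert i ∈ G.An (insert β Z) := by
  induction k with
  | zero =>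
    intro i hi hd
    refine mem_An_of_dir hd (subset_An _ ?_)
    rw [ρ.getVert_of_length_le (by omega)]
    exact Set.mem_insert _ _
  | succ k ih =>
    intro i hi hd
    refine mem_An_of_dir hd ?_
    by_cases hc : G.IsCollider (ρ.getVert i) (ρ.getVert (i + 1)) (ρ.getVert (i + 2))
    · exact An_mono (Set.subset_insert _ _) ((h.2.2.2 i (by omega)).2 hc)
    · refine ih (i + 1) (by omega) (dir_of_adj_of_not_arrowInto
        (ρ.adj_getVert_succ (by omega)).symm fun ha => hc ⟨Or.inl hd, ha⟩)

theorem IsMConnecting.mem_An_of_succ_dir (h : G.IsMConnecting ρ Z) :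
    ∀ i, i + 1 ≤ ρ.length → G.dir (ρ.getVert (i + 1)) (ρ.getVert i) →
      ρ.getVert (i + 1) ∈ G.An (insert α Z) := by
  intro i
  induction i with
  | zero =>
    intro _ hd
    refine mem_An_of_dir hd (subset_An _ ?_)
    rw [ρ.getVert_zero]
    exact Set.mem_insert _ _
  | succ i ih =>
    intro hi hd
    refine mem_An_of_dir hd ?_
    by_cases hc : G.IsCollider (ρ.getVert i) (ρ.getVert (i + 1)) (ρ.getVert (i + 2))
    · exact An_mono (Set.subset_insert _ _) ((h.2.2.2 i (by omega)).2 hc)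
    · refine ih (by omega) (dir_of_adj_of_not_arrowInto
        (ρ.adj_getVert_succ (by omega)) fun ha => hc ⟨ha, Or.inl hd⟩)

/-- The inner vertices of an `m`-connecting chain are ancestors of its ends or of the
conditioning set. -/
theorem IsMConnecting.getVert_mem_An (h : G.IsMConnecting ρ Z) {i : ℕ} (hi : i + 2 ≤ ρ.length) :
    ρ.getVert (i + 1) ∈ G.An ({α, β} ∪ Z) := by
  by_cases hc : G.IsCollider (ρ.getVert i) (ρ.getVert (i + 1)) (ρ.getVert (i + 2))
  · exact An_mono Set.subset_union_right ((h.2.2.2 i hi).2 hc)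
  · rcases not_and_or.1 hc with hc | hc
    · refine An_mono ?_ (h.mem_An_of_succ_dir i (by omega)
        (dir_of_adj_of_not_arrowInto (ρ.adj_getVert_succ (by omega)) hc))
      rintro x (rfl | hx) <;> simp_all
    · refine An_mono ?_ (h.mem_An_of_dir_succ (ρ.length - (i + 2)) (i + 1) (by omega)
        (dir_of_adj_of_not_arrowInto (ρ.adj_getVert_succ (by omega)).symm hc))
      rintro x (rfl | hx) <;> simp_all

end Connecting

/-- An `m`-connecting chain from `v` to a non-adjacent vertex `u` that does not come after `v`,
given ancestors of `u` and `v`, starts with a parent of `v` outside the conditioning set. -/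
theorem IsMConnecting.dir_of_cons {u v y : V} (huv : ¬ G.skeleton.Adj v u)
    (hbefore : ¬ G.StrictlyPrecedes v u) {Z : Set V} (hZ : Z ⊆ G.An {v, u})
    {hvy : G.skeleton.Adj v y} {ρ : G.skeleton.Walk y u}
    (h : G.IsMConnecting (.cons hvy ρ) Z) : G.dir y v ∧ y ∉ Z := by
  have hyu : y ≠ u := by
    rintro rfl
    exact huv hvy
  have hlen : 0 + 2 ≤ (SimpleGraph.Walk.cons hvy ρ).length := by
    have := SimpleGraph.Walk.not_nil_of_ne (p := ρ) hyu
    rw [← SimpleGraph.Walk.length_eq_zero_iff] at this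
    simp only [SimpleGraph.Walk.length_cons]
    omega
  have hmem := An_subset_An (Set.union_subset (subset_An _) hZ) (h.getVert_mem_An hlen)
  have hcond := (h.2.2.2 0 hlen).1
  simp only [SimpleGraph.Walk.getVert_cons_succ, SimpleGraph.Walk.getVert_zero] at hmem hcond
  have hdir : G.dir y v := by
    by_contra hn
    -- Otherwise the edge points into `y`, and a nontrivial directed path from `y` to `v` or `u`
    -- makes `v` strictly precede itself or `u`.
    have hinto : G.ArrowInto v y := by
      rcases hvy with hd | hd | hd
      · exact Or.inl hd
      · exact absurd hd hn
      · exact Or.inr hd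
    obtain ⟨z, hz, hp⟩ := hmem
    have hstep : ∀ z, y ≠ z → Relation.ReflTransGen G.dir y z → G.StrictlyPrecedes v z := by
      intro z hne hp
      rcases hp.cases_head with rfl | ⟨c, hyc, hcz⟩
      · exact absurd rfl hne
      · exact ⟨y, c, .single hinto, hyc, Precedes.of_dir hcz⟩
    rcases hz with rfl | rfl
    · exact (hstep z hvy.ne' hp).asymm (hstep z hvy.ne' hp)
    · exact hbefore (hstep z hyu hp)
  exact ⟨hdir, hcond fun hc => hc.1.not_dir hdir⟩

theorem mSeparated_singleton {u v : V} {Z : Set V} (huv : v ≠ u) (hv : v ∉ Z) (hu : u ∉ Z)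
    (h : ∀ y (hvy : G.skeleton.Adj v y) (ρ : G.skeleton.Walk y u),
      ¬ G.IsMConnecting (.cons hvy ρ) Z) : G.MSeparated {v} {u} Z := by
  refine ⟨by simpa using huv, by simpa using hv, by simpa using hu, ?_⟩
  rintro _ rfl _ rfl ⟨ρ, hρ⟩
  cases ρ with
  | nil => exact huv rfl
  | cons hvy ρ => exact h _ hvy ρ hρ

theorem mSeparated_parents {u v : V} (huv : v ≠ u) (hadj : ¬ G.skeleton.Adj v u)
    (hbefore : ¬ G.StrictlyPrecedes v u) : G.MSeparated {v} {u} {y | G.dir y v} := by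
  refine mSeparated_singleton huv (G.dir_irrefl v) (fun h => hadj (Or.inr (Or.inl h)))
    fun y hvy ρ hρ => ?_
  obtain ⟨h1, h2⟩ := hρ.dir_of_cons hadj hbefore
    fun y hy => mem_An_of_dir hy (subset_An _ (Set.mem_insert _ _))
  exact h2 h1

/-- If the parents of `v` lie in `S ∪ Y` and `Y` is `m`-separated from a vertex `u` given
`S ∋ v`, then the ancestors of `u` and `v` in `S` separate `u` from `v`. -/
theorem MSeparated.mSeparated_ancestors {u v : V} {X Y S : Set V} (hsep : G.MSeparated Y X S)
    (hu : u ∈ X) (hv : v ∈ S) (hpa : ∀ y, G.dir y v → y ∈ S ∪ Y)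
    (hadj : ¬ G.skeleton.Adj v u) (hbefore : ¬ G.StrictlyPrecedes v u) :
    G.MSeparated {v} {u} {x | x ∈ S ∧ x ∈ G.An {v, u} ∧ x ≠ v} := by
  have huS : u ∉ S := hsep.2.2.1.notMem_of_mem_left hu
  refine mSeparated_singleton (fun e => huS (e ▸ hv)) (fun h => h.2.2 rfl) (fun h => huS h.1)
    fun y hvy ρ hρ => ?_
  set Z := {x | x ∈ S ∧ x ∈ G.An {v, u} ∧ x ≠ v}
  have hZ : Z ⊆ G.An {v, u} := fun x hx => hx.2.1
  obtain ⟨hyv, hyZ⟩ := hρ.dir_of_cons hadj hbefore hZ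
  have hyS : y ∉ S := fun h =>
    hyZ ⟨h, mem_An_of_dir hyv (subset_An _ (Set.mem_insert _ _)), hvy.ne'⟩
  obtain ⟨hpath, hvρ⟩ := (SimpleGraph.Walk.cons_isPath_iff hvy ρ).1 hρ.1
  -- The tail from `y` to `u` avoids `v` and its inner vertices are ancestors of `u` or `v`, so
  -- there `S` and `Z` agree; the tail therefore connects `y` and `u` given `S`.
  refine hsep.2.2.2 y ((hpa y hyv).resolve_left hyS) u hu ⟨ρ, hpath, hyS, huS, fun i hi => ?_⟩
  have hlen : i + 1 + 2 ≤ (SimpleGraph.Walk.cons hvy ρ).length := by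
    simp only [SimpleGraph.Walk.length_cons]
    omega
  have hmem := An_subset_An (Set.union_subset (subset_An _) hZ) (hρ.getVert_mem_An hlen)
  have hcond := hρ.2.2.2 (i + 1) hlen
  simp only [SimpleGraph.Walk.getVert_cons_succ] at hmem hcond
  refine ⟨fun hn hS => hcond.1 hn ⟨hS, hmem, ?_⟩, fun hc => An_mono (fun x hx => hx.1) (hcond.2 hc)⟩
  rintro hx
  exact hvρ (hx ▸ ρ.getVert_mem_support _)

end ChainGraph

/-! ### Separation trees and separators inside nodes -/

section Tree

variable {V ι : Type*} {T : SimpleGraph ι} {C : ι → Finset V}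

theorem mem_side_self {i j : ι} {x : V} (hx : x ∈ C i) : x ∈ side T C i j :=
  ⟨i, .refl _, hx⟩

theorem mem_side_of_isPath_cons {i j k : ι} {x : V} {hij : T.Adj i j} {q : T.Walk j k}
    (hq : (SimpleGraph.Walk.cons hij q).IsPath) (hx : x ∈ C k) : x ∈ side T C j i := by
  refine ⟨k, ⟨q.toDeleteEdges _ fun e he => ?_⟩, hx⟩
  rintro rfl
  exact ((SimpleGraph.Walk.cons_isPath_iff hij q).1 hq).2 (q.snd_mem_support_of_mem_edges he)

theorem reachable_deleteEdges_or {i j : ι} {k : ι} (h : T.Reachable i k) :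
    (T.deleteEdges {s(i, j)}).Reachable i k ∨ (T.deleteEdges {s(j, i)}).Reachable j k := by
  rw [SimpleGraph.reachable_iff_reflTransGen] at h
  induction h with
  | refl => exact Or.inl (.refl _)
  | @tail b c _ hbc ih =>
    by_cases he : s(b, c) = s(i, j)
    · rcases Sym2.eq_iff.1 he with ⟨_, rfl⟩ | ⟨_, rfl⟩
      · exact Or.inr (.refl _)
      · exact Or.inl (.refl _)
    · have h1 : (T.deleteEdges {s(i, j)}).Adj b c := by simpa [hbc] using he
      have h2 : (T.deleteEdges {s(j, i)}).Adj b c := by rwa [Sym2.eq_swap (a := j)]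
      exact ih.imp (fun h => h.trans h1.reachable) fun h => h.trans h2.reachable

variable [DecidableEq V] {G : ChainGraph V}

namespace IsMSeparationTree

theorem mem_side_or (hT : IsMSeparationTree G T C) (i j : ι) (x : V) :
    x ∈ side T C i j ∨ x ∈ side T C j i := by
  obtain ⟨k, hk⟩ := hT.cover x
  exact (reachable_deleteEdges_or (hT.isTree.connected i k)).imp (fun h => ⟨k, h, hk⟩)
    fun h => ⟨k, h, hk⟩

/-- This is the running intersection property, coming from the disjointness required by
`m`-separation. -/
theorem mem_of_mem_sides (hT : IsMSeparationTree G T C) {i j : ι} (hij : T.Adj i j) {x : V}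
    (hi : x ∈ side T C i j) (hj : x ∈ side T C j i) : x ∈ C i ∩ C j := by
  by_contra hx
  exact (hT.separates i j hij).1.notMem_of_mem_left ⟨hi, hx⟩ ⟨hj, hx⟩

/-- Two vertices that are not separated by any edge of the tree are contained in a common node. -/
theorem exists_common_node (hT : IsMSeparationTree G T C) {u v : V}
    (h : ∀ i j, T.Adj i j → u ∈ side T C i j \ ↑(C i ∩ C j) →
      v ∉ side T C j i \ ↑(C i ∩ C j)) : ∃ k, u ∈ C k ∧ v ∈ C k := by
  obtain ⟨i, hi⟩ := hT.cover u
  obtain ⟨k, hk⟩ := hT.cover v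
  obtain ⟨q, hq⟩ := (hT.isTree.connected i k).exists_isPath
  induction q with
  | nil => exact ⟨_, hi, hk⟩
  | @cons i j k hij q ih =>
    by_cases huj : u ∈ C j
    · exact ih huj hk hq.of_cons
    · by_cases hvi : v ∈ C i
      · exact ⟨i, hi, hvi⟩
      · refine absurd ⟨mem_side_of_isPath_cons hq hk, ?_⟩ (h i j hij ⟨mem_side_self hi, ?_⟩)
        · simp [huj]
        · simp [hvi]

theorem exists_common_node_of_adj (hT : IsMSeparationTree G T C) {u v : V}
    (h : G.skeleton.Adj u v) : ∃ k, u ∈ C k ∧ v ∈ C k :=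
  hT.exists_common_node fun i j hij hu hv => (hT.separates i j hij).not_adj hu hv h

theorem exists_common_node_of_isCollider (hT : IsMSeparationTree G T C) {u w v : V}
    (h : G.IsCollider u w v) : ∃ k, u ∈ C k ∧ v ∈ C k := by
  refine hT.exists_common_node fun i j hij hu hv => ?_
  -- The collider `w` is outside the intersection, hence strictly on one side, yet it is adjacent to
  -- a vertex strictly on the other.
  have hsep := hT.separates i j hij
  have hw : w ∉ (↑(C i ∩ C j) : Set V) := fun hw =>
    (hsep.mem_iff hu hv h.1.adj h.2.adj.symm).1 hw h
  rcases hT.mem_side_or i j w with hw' | hw'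
  · exact hsep.not_adj ⟨hw', hw⟩ hv h.2.adj.symm
  · exact hsep.not_adj hu ⟨hw', hw⟩ h.1.adj

/-- From a node containing `u` and `v` one can move towards a node containing a further parent `y`
of `v`, keeping the parents already present, unless a node containing a separator of `u` and `v`
is met on the way. -/
theorem exists_separator_or_parent_mem (hT : IsMSeparationTree G T C) {u v y : V}
    (hadj : ¬ G.skeleton.Adj v u) (hbefore : ¬ G.StrictlyPrecedes v u) (hy : G.dir y v)
    {h k : ι} (q : T.Walk h k) (hq : q.IsPath) (hu : u ∈ C h) (hv : v ∈ C h) (hyk : y ∈ C k)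
    (hvk : v ∈ C k) :
    (∃ i, ∃ S ⊆ C i, u ∈ C i ∧ v ∈ C i ∧ G.MSeparated {v} {u} (S : Set V)) ∨
      ∃ i, u ∈ C i ∧ v ∈ C i ∧ y ∈ C i ∧ ∀ x, G.dir x v → x ∈ C h → x ∈ C i := by
  classical
  induction q with
  | nil => exact Or.inr ⟨_, hu, hv, hyk, fun _ _ => id⟩
  | @cons i j k hij q ih =>
    by_cases hyi : y ∈ C i
    · exact Or.inr ⟨i, hu, hv, hyi, fun _ _ => id⟩
    have hvS : v ∈ C j ∩ C i := hT.mem_of_mem_sides hij.symm (mem_side_of_isPath_cons hq hvk)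
      (mem_side_self hv)
    have hvj : v ∈ C j := (Finset.mem_inter.1 hvS).1
    have hyY : y ∈ side T C j i \ ↑(C j ∩ C i) :=
      ⟨mem_side_of_isPath_cons hq hyk, by simp [hyi]⟩
    have hsep := hT.separates j i hij.symm
    -- A parent strictly on the opposite side from `y` would make `v`, which is in the intersection,
    -- an unblocked collider.
    have hpa : ∀ x, G.dir x v → x ∈ ↑(C j ∩ C i) ∪ side T C j i \ ↑(C j ∩ C i) := by
      intro x hx
      by_contra hn
      rw [Set.mem_union, not_or] at hn
      have hxX : x ∈ side T C i j \ ↑(C j ∩ C i) :=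
        ⟨(hT.mem_side_or i j x).resolve_right fun h => hn.2 ⟨h, hn.1⟩, hn.1⟩
      exact (hsep.mem_iff hyY hxX (Or.inl hy) (Or.inr (Or.inl hx))).1 hvS ⟨Or.inl hy, Or.inl hx⟩
    by_cases huj : u ∈ C j
    · refine (ih hq.of_cons huj hvj hyk hvk).imp_right ?_
      rintro ⟨l, h1, h2, h3, h4⟩
      refine ⟨l, h1, h2, h3, fun x hx hxi => h4 x hx ?_⟩
      rcases hpa x hx with hxS | hxY
      · exact (Finset.mem_inter.1 hxS).1
      · exact (Finset.mem_inter.1 (hT.mem_of_mem_sides hij.symm hxY.1 (mem_side_self hxi))).1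
    · refine Or.inl ⟨i, (C j ∩ C i).filter fun x => x ∈ G.An {v, u} ∧ x ≠ v,
        fun x hx => (Finset.mem_inter.1 (Finset.mem_filter.1 hx).1).2, hu, hv, ?_⟩
      rw [Finset.coe_filter]
      exact hsep.mSeparated_ancestors ⟨mem_side_self hu, by simp [huj]⟩ hvS hpa hadj hbefore

theorem exists_separator_of_not_strictlyPrecedes [Finite V] (hT : IsMSeparationTree G T C)
    {u v : V} (hne : v ≠ u) (hadj : ¬ G.skeleton.Adj v u) (hbefore : ¬ G.StrictlyPrecedes v u)
    {h : ι} (hu : u ∈ C h) (hv : v ∈ C h) :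
    ∃ i, ∃ S ⊆ C i, u ∈ C i ∧ v ∈ C i ∧ G.MSeparated {v} {u} (S : Set V) := by
  classical
  by_contra hno
  have key : ∀ P : Set V, P.Finite → P ⊆ {y | G.dir y v} →
      ∃ i, u ∈ C i ∧ v ∈ C i ∧ ∀ y ∈ P, y ∈ C i := by
    intro P hP
    induction P, hP using Set.Finite.induction_on with
    | empty => exact fun _ => ⟨h, hu, hv, by simp⟩
    | @insert y P _ _ ih =>
      intro hPv
      obtain ⟨hyv, hPv⟩ := Set.insert_subset_iff.1 hPv
      obtain ⟨i, hui, hvi, hPi⟩ := ih hPv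
      obtain ⟨k, hyk, hvk⟩ := hT.exists_common_node_of_adj (G := G) (Or.inl hyv)
      obtain ⟨q, hq⟩ := (hT.isTree.connected i k).exists_isPath
      obtain ⟨l, hul, hvl, hyl, hl⟩ := (hT.exists_separator_or_parent_mem hadj hbefore hyv q hq
        hui hvi hyk hvk).resolve_left hno
      refine ⟨l, hul, hvl, ?_⟩
      rintro x (rfl | hx)
      · exact hyl
      · exact hl x (hPv hx) (hPi x hx)
  obtain ⟨i, hui, hvi, hi⟩ := key _ (Set.toFinite _) subset_rfl
  refine hno ⟨i, (C i).filter fun y => G.dir y v, Finset.filter_subset _ _, hui, hvi, ?_⟩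
  convert ChainGraph.mSeparated_parents hne hadj hbefore using 1
  ext y
  simpa using hi y

end IsMSeparationTree

end Tree

/-! ### Correctness of the algorithm -/

section Algorithm

variable {V ι : Type*} [Finite V] {E : V → Type*} [∀ v, MeasurableSpace (E v)]
  [∀ v, StandardBorelSpace (E v)] {p : Measure (∀ v, E v)} [IsProbabilityMeasure p]
  {G : ChainGraph V} {C : ι → Finset V}

theorem Faithful.condIndepGiven_singleton_iff (hp : Faithful p G) {u v : V} {S : Finset V}
    (hne : u ≠ v) (hu : u ∉ S) (hv : v ∉ S) :
    CondIndepGiven p {u} {v} S ↔ G.MSeparated {u} {v} (S : Set V) := by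
  simpa using hp {u} {v} S (by simp) (by simp) (by simpa using hne) (by simpa using hu)
    (by simpa using hv)

namespace SeparatorSearch

variable (R : SeparatorSearch p C)

theorem mSeparated_of_found (hp : Faithful p G) {h : ι} {u v : V} {S : Finset V}
    (hS : R.found h s(u, v) = some S) : u ≠ v ∧ G.MSeparated {u} {v} (S : Set V) := by
  obtain ⟨hne, -, -, -, hu, hv, hci⟩ := R.sound h u v S hS
  exact ⟨hne, (hp.condIndepGiven_singleton_iff hne hu hv).1 hci⟩

theorem found_eq_none_of_adj (hp : Faithful p G) {u v : V} (h : G.skeleton.Adj u v) (k : ι) :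
    R.found k s(u, v) = none := by
  by_contra hn
  obtain ⟨S, hS⟩ := Option.ne_none_iff_exists'.1 hn
  exact (R.mSeparated_of_found hp hS).2.not_adj rfl rfl h

theorem unionSkeleton_adj_iff {u v : V} :
    R.unionSkeleton.Adj u v ↔ ∃ h, u ≠ v ∧ u ∈ C h ∧ v ∈ C h ∧ R.found h s(u, v) = none := by
  simp only [unionSkeleton, SimpleGraph.iSup_adj]
  rfl

variable [DecidableEq V] {T : SimpleGraph ι}

theorem exists_found_of_not_strictlyPrecedes (hp : Faithful p G) (hT : IsMSeparationTree G T C)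
    {u v : V} (hne : v ≠ u) (hadj : ¬ G.skeleton.Adj v u) (hbefore : ¬ G.StrictlyPrecedes v u)
    {h : ι} (hu : u ∈ C h) (hv : v ∈ C h) :
    ∃ k S, u ∈ C k ∧ v ∈ C k ∧ R.found k s(v, u) = some S := by
  obtain ⟨k, S, hS, huk, hvk, hsep⟩ :=
    hT.exists_separator_of_not_strictlyPrecedes hne hadj hbefore hu hv
  have hvS : v ∉ S := hsep.2.1.notMem_of_mem_left rfl
  have huS : u ∉ S := hsep.2.2.1.notMem_of_mem_left rfl
  obtain ⟨S', hS'⟩ := Option.ne_none_iff_exists'.1 (R.complete k v u hne hvk huk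
    ⟨S, hS, hvS, huS, (hp.condIndepGiven_singleton_iff hne hvS huS).2 hsep⟩)
  exact ⟨k, S', huk, hvk, hS'⟩

/-- For non-adjacent vertices that lie in a common node, a separator is found at some node. -/
theorem exists_found (hp : Faithful p G) (hT : IsMSeparationTree G T C)
    {u v : V} (hne : u ≠ v) (hadj : ¬ G.skeleton.Adj u v) {h : ι} (hu : u ∈ C h) (hv : v ∈ C h) :
    ∃ k S, u ∈ C k ∧ v ∈ C k ∧ R.found k s(u, v) = some S := by
  by_cases hb : G.StrictlyPrecedes v u
  · obtain ⟨k, S, hvk, huk, hS⟩ :=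
      R.exists_found_of_not_strictlyPrecedes hp hT hne hadj hb.asymm hv hu
    exact ⟨k, S, huk, hvk, hS⟩
  · obtain ⟨k, S, huk, hvk, hS⟩ := R.exists_found_of_not_strictlyPrecedes hp hT hne.symm
      (fun h => hadj h.symm) hb hu hv
    exact ⟨k, S, huk, hvk, by rwa [Sym2.eq_swap]⟩

theorem globalSkeleton_eq (hp : Faithful p G) (hT : IsMSeparationTree G T C) :
    R.globalSkeleton = G.skeleton := by
  ext u v
  constructor
  · rintro ⟨hadj, hdel⟩
    obtain ⟨h, hne, hu, hv, hnone⟩ := R.unionSkeleton_adj_iff.1 hadj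
    by_contra hG
    obtain ⟨k, S, huk, hvk, hS⟩ := R.exists_found hp hT hne hG hu hv
    refine hdel ⟨hadj, ⟨h, k, ?_, hu, hv, huk, hvk⟩, k, huk, hvk, fun hl => ?_⟩
    -- The search failed at `h` but succeeded at `k`, so these are two distinct nodes, as `Deleted`
    -- requires.
    · rintro rfl
      simp [hnone] at hS
    · simp [hl.2.2.2] at hS
  · intro hG
    obtain ⟨h, hu, hv⟩ := hT.exists_common_node_of_adj hG
    refine ⟨R.unionSkeleton_adj_iff.2 ⟨h, hG.ne, hu, hv, R.found_eq_none_of_adj hp hG h⟩, ?_⟩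
    rintro ⟨-, -, k, huk, hvk, hk⟩
    exact hk ⟨hG.ne, huk, hvk, R.found_eq_none_of_adj hp hG k⟩

theorem determined_iff (hp : Faithful p G) (hT : IsMSeparationTree G T C) (u w v : V) :
    R.Determined u w v ↔ G.IsVStructure u w v := by
  rw [Determined, R.globalSkeleton_eq hp hT]
  constructor
  · rintro ⟨S, ⟨h, hS⟩, huw, hwv, hwS⟩
    obtain ⟨hne, hsep⟩ := R.mSeparated_of_found hp hS
    have hcol : G.IsCollider u w v := by
      by_contra hn
      exact hwS ((hsep.mem_iff rfl rfl huw hwv).2 hn)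
    exact ⟨hne, hsep.not_adj rfl rfl, hcol⟩
  · rintro ⟨hne, hadj, hcol⟩
    obtain ⟨h, hu, hv⟩ := hT.exists_common_node_of_isCollider hcol
    obtain ⟨k, S, -, -, hS⟩ := R.exists_found hp hT hne hadj hu hv
    refine ⟨S, ⟨k, hS⟩, hcol.1.adj, hcol.2.adj.symm, fun hwS => ?_⟩
    exact ((R.mSeparated_of_found hp hS).2.mem_iff rfl rfl hcol.1.adj hcol.2.adj.symm).1 hwS hcol

theorem output_eq (hp : Faithful p G) (hT : IsMSeparationTree G T C) : R.output = G.pattern := by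
  ext u w
  · change R.globalSkeleton.Adj u w ↔ G.skeleton.Adj u w
    rw [R.globalSkeleton_eq hp hT]
  · exact exists_congr fun v => R.determined_iff hp hT u w v

end SeparatorSearch

end Algorithm

end MVR

theorem mainTheorem4 {V ι : Type*} [Finite V] [DecidableEq V] [Finite ι]
    {E : V → Type*} [∀ v, MeasurableSpace (E v)] [∀ v, StandardBorelSpace (E v)]
    (p : MeasureTheory.Measure (∀ v, E v)) [MeasureTheory.IsProbabilityMeasure p]
    (G : MVR.ChainGraph V) (hfaithful : MVR.Faithful p G)
    (T : SimpleGraph ι) (C : ι → Finset V) (hT : MVR.IsMSeparationTree G T C)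
    (R : MVR.SeparatorSearch p C) :
    R.globalSkeleton = G.skeleton ∧
      (∀ u w v : V, R.Determined u w v ↔ G.IsVStructure u w v) ∧
      R.output = G.pattern := by
  exact ⟨R.globalSkeleton_eq hfaithful hT, R.determined_iff hfaithful hT,
    R.output_eq hfaithful hT⟩
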